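/- Let $p$ be an odd prime. If $p \equiv 1 \pmod 8$, then $2$ is a square modulo $p$, and we write $\left(\frac{2}{p}\right)_4 = 1$ if $2$ is a fourth power modulo $p$ and $\left(\frac{2}{p}\right)_4 = -1$ otherwise. (1) Suppose $p \equiv 9 \pmod{16}$. If $\left(\frac{2}{p}\right)_4 = -1$, then the equation $x^2 - 2py^2 = -1$ has a solution $(x,y) \in \mathbb{Z}^2$. If $\left(\frac{2}{p}\right)_4 = 1$, then the equation $x^2 - 2py^2 = -2$ has a solution $(x,y) \in \mathbb{Z}^2$. (2) Suppose $p \equiv 1 \pmod{16}$. If $\left(\frac{2}{p}\right)_4 = -1$, then the equation $x^2 - 2py^2 = 2$ has a solution $(x,y) \in \mathbb{Z}^2$. -/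

import Mathlib

open scoped Classical in
/-- The rational quartic residue symbol `(a/p)_4` for a prime `p ≡ 1 mod 4`: for a quadratic
residue `a` prime to `p`, it is `1` if `a` is a fourth power modulo `p` and `-1` if it is not.
Outside the domain of the symbol (when `p ∣ a`, or `a` is not a square modulo `p`)
it is given the value `0`. -/
noncomputable def quarticSymbol (a : ℤ) (p : ℕ) : ℤ :=
  if (a : ZMod p) = 0 then 0
  else if ∃ z : ZMod p, z ^ 4 = (a : ZMod p) then 1
  else if IsSquare (a : ZMod p) then -1
  else 0

/-!
Let `(T, U)` be the fundamental solution of `T² - 2pU² = 1`. Here `T = 2m + 1` and `U = 2u`, so that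
`m (m + 1) = 2pu²` with coprime factors. Distributing the primes `2` and `p` over the two factors
shows that one of `a² - 2pb² = -1`, `2a² - pb² = 1`, `2a² - pb² = -1` is solvable: the remaining
possibility `a² - 2pb² = 1` would be a smaller solution of the original equation
(`exists_half_pell`). The last two equations yield `x² - 2py² = 2` and `x² - 2py² = -2` on
putting `x = 2a`.

It remains to rule out two of the three, given `p` modulo `16` and the quartic character of `2`.
If `p ≡ 1 (mod 8)` and `a ∣ pb² - 1`, then `a` is a square modulo `p`, by quadratic reciprocity
for each prime factor of `a` (`isSquare_intCast_of_dvd`). This is used as follows.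
* If `2a² - pb² = -1`, then `a` is a square and `-1` a fourth power modulo `p`, so `2` is a fourth
  power (`exists_pow_four_eq_two`).
* If `2a² - pb² = 1`, then `2` is a square modulo every prime factor of `b`, so `b ≡ ±1 (mod 8)`,
  and `p ≡ pb² = 2a² - 1 ≡ 1 (mod 16)` (`mod_sixteen_eq_one`).
* If `x² - 2py² = -1`, then `x + 1` is a square modulo `p`, so `2x = (x + 1)²` is a fourth
  power. As `x` has order `4` modulo `p`, it is a fourth power exactly when `p ≡ 1 (mod 16)`, so
  the same holds for `2` (`exists_pow_four_eq_two_iff`).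
-/

/-! ### Descent from the fundamental solution of the Pell equation -/

theorem Nat.Coprime.exists_sq_of_mul_eq_sq {a b c : ℕ} (hab : a.Coprime b) (h : a * b = c ^ 2) :
    ∃ d e : ℕ, a = d ^ 2 ∧ b = e ^ 2 := by
  obtain ⟨d, hd⟩ := exists_eq_pow_of_mul_eq_pow (Nat.isUnit_iff.2 hab) h
  obtain ⟨e, he⟩ := exists_eq_pow_of_mul_eq_pow (Nat.isUnit_iff.2 hab.symm) (mul_comm a b ▸ h)
  exact ⟨d, e, hd, he⟩

theorem exists_sq_of_consecutive_mul_eq {p m u : ℕ} (hp : p.Prime) (hp2 : p ≠ 2)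
    (h : m * (m + 1) = 2 * p * u ^ 2) :
    ∃ a b : ℕ, (m = 2 * p * a ^ 2 ∧ m + 1 = b ^ 2) ∨ (m = a ^ 2 ∧ m + 1 = 2 * p * b ^ 2) ∨
      (m = p * a ^ 2 ∧ m + 1 = 2 * b ^ 2) ∨ (m = 2 * a ^ 2 ∧ m + 1 = p * b ^ 2) := by
  have hc : m.Coprime (m + 1) := by simp
  have h2p : Nat.Coprime 2 p := (Nat.coprime_primes Nat.prime_two hp).2 hp2.symm
  have hpos : 0 < 2 * p := by have := hp.pos; omega
  have hpm : p ∣ m ∨ p ∣ m + 1 := hp.dvd_mul.1 (h ▸ Dvd.intro _ (by ring : p * (2 * u ^ 2) = _))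
  have h2m : 2 ∣ m ∨ 2 ∣ m + 1 := by omega
  rcases hpm with hpm | hpm <;> rcases h2m with h2m | h2m
  · obtain ⟨k, hk⟩ := h2p.mul_dvd_of_dvd_of_dvd h2m hpm
    have hcop : k.Coprime (m + 1) := hc.coprime_dvd_left (Dvd.intro_left _ hk.symm)
    obtain ⟨d, e, hd, he⟩ := hcop.exists_sq_of_mul_eq_sq (c := u)
      (Nat.eq_of_mul_eq_mul_left hpos (by rw [← h, ← mul_assoc, ← hk]))
    exact ⟨d, e, Or.inl ⟨by rw [← hd, hk], he⟩⟩
  · obtain ⟨k, hk⟩ := hpm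
    obtain ⟨l, hl⟩ := h2m
    have hcop : k.Coprime l := (hc.coprime_dvd_left (Dvd.intro_left _ hk.symm)).coprime_dvd_right
      (Dvd.intro_left _ hl.symm)
    obtain ⟨d, e, hd, he⟩ := hcop.exists_sq_of_mul_eq_sq (c := u)
      (Nat.eq_of_mul_eq_mul_left hpos (by rw [← h, hl, hk]; ring))
    exact ⟨d, e, Or.inr (Or.inr (Or.inl ⟨by rw [← hd, hk], by rw [← he, hl]⟩))⟩
  · obtain ⟨k, hk⟩ := h2m
    obtain ⟨l, hl⟩ := hpm
    have hcop : k.Coprime l := (hc.coprime_dvd_left (Dvd.intro_left _ hk.symm)).coprime_dvd_right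
      (Dvd.intro_left _ hl.symm)
    obtain ⟨d, e, hd, he⟩ := hcop.exists_sq_of_mul_eq_sq (c := u)
      (Nat.eq_of_mul_eq_mul_left hpos (by rw [← h, hl, hk]; ring))
    exact ⟨d, e, Or.inr (Or.inr (Or.inr ⟨by rw [← hd, hk], by rw [← he, hl]⟩))⟩
  · obtain ⟨k, hk⟩ := h2p.mul_dvd_of_dvd_of_dvd h2m hpm
    have hcop : m.Coprime k := hc.coprime_dvd_right (Dvd.intro_left _ hk.symm)
    obtain ⟨d, e, hd, he⟩ := hcop.exists_sq_of_mul_eq_sq (c := u)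
      (Nat.eq_of_mul_eq_mul_left hpos (by rw [← h, hk]; ring))
    exact ⟨d, e, Or.inr (Or.inl ⟨hd, by rw [← he, hk]⟩)⟩

theorem exists_half_pell {p : ℕ} (hp : p.Prime) (hp2 : p ≠ 2) :
    ∃ a b : ℤ, a ^ 2 - 2 * p * b ^ 2 = -1 ∨ 2 * a ^ 2 - p * b ^ 2 = 1 ∨
      2 * a ^ 2 - p * b ^ 2 = -1 := by
  have hnsq : ¬ IsSquare ((2 * p : ℤ)) := by
    rintro ⟨r, hr⟩
    have h2r : (2 : ℤ) ∣ r := by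
      have : (2 : ℤ) ∣ r * r := ⟨p, hr.symm⟩
      rcases Int.prime_two.dvd_mul.1 this with h | h <;> exact h
    obtain ⟨s, rfl⟩ := h2r
    have : (p : ℤ) = 2 * (s * s) := by linarith
    have : 2 ∣ p := by omega
    exact hp2 ((Nat.prime_dvd_prime_iff_eq Nat.prime_two hp).1 this).symm
  have hp0 : (0 : ℤ) < 2 * p := by have := hp.pos; omega
  obtain ⟨s, hs1, hs2, hmin⟩ := Pell.IsFundamental.exists_of_not_isSquare hp0 hnsq
  have hs := s.prop
  -- `T² = 1 + 2pU²` is odd, hence so is `T`; then `8 ∣ T² - 1 = 2pU²` forces `U` to be even.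
  have hTodd : Odd s.x := by
    have : Odd (s.x ^ 2) := ⟨p * s.y ^ 2, by linarith⟩
    exact (Int.odd_pow.1 this).resolve_right (by norm_num)
  have hpodd : Odd (p : ℤ) := by exact_mod_cast hp.odd_of_ne_two hp2
  obtain ⟨m, hm⟩ := hTodd
  have hUeven : Even s.y := by
    by_contra hU
    have : Odd ((p : ℤ) * s.y ^ 2) := hpodd.mul (Int.not_even_iff_odd.1 hU).pow
    obtain ⟨k, hk⟩ := this
    have : 2 * (m * m + m) = 2 * k + 1 := by
      rw [hm] at hs; linarith
    omega
  obtain ⟨u, hu⟩ := hUeven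
  lift m to ℕ using by omega
  lift u to ℕ using by omega
  have key : m * (m + 1) = 2 * p * u ^ 2 := by
    zify
    rw [hm, hu] at hs
    linarith
  obtain ⟨a, b, h⟩ := exists_sq_of_consecutive_mul_eq hp hp2 key
  zify at h
  rcases h with ⟨h1, h2⟩ | ⟨h1, h2⟩ | ⟨h1, h2⟩ | ⟨h1, h2⟩
  · -- `(b, a)` solves the same Pell equation with `1 < b < b² + (b² - 1) = T`.
    exfalso
    have hb : (1 : ℤ) < b := by nlinarith
    have := hmin (b := Pell.Solution₁.mk b a (by linarith)) (by simpa using hb)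
    rw [Pell.Solution₁.x_mk] at this
    nlinarith
  · exact ⟨a, b, Or.inl (by linarith)⟩
  · exact ⟨b, a, Or.inr (Or.inl (by linarith))⟩
  · exact ⟨a, b, Or.inr (Or.inr (by linarith))⟩

/-! ### Square classes from prime factors -/

theorem isSquare_natCast_of_forall_prime {R : Type*} [CommSemiring R] (n : ℕ)
    (h : ∀ q : ℕ, q.Prime → q ∣ n → IsSquare (q : R)) : IsSquare (n : R) := by
  induction n using induction_on_primes with
  | zero => simp
  | one => simp
  | prime_mul q a hq ih =>
    rw [Nat.cast_mul]
    exact (h q hq (dvd_mul_right q a)).mul (ih fun r hr hra ↦ h r hr (hra.mul_left q))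

theorem isSquare_intCast_of_dvd {p : ℕ} [Fact p.Prime] (hp8 : p % 8 = 1) {a b : ℤ}
    (h : a ∣ p * b ^ 2 - 1) : IsSquare (a : ZMod p) := by
  have hp2 : p ≠ 2 := by omega
  have hnat : IsSquare (a.natAbs : ZMod p) := by
    refine isSquare_natCast_of_forall_prime _ fun q hq hqa ↦ ?_
    rcases eq_or_ne q 2 with rfl | hq2
    · exact_mod_cast (ZMod.exists_sq_eq_two_iff hp2).2 (Or.inl hp8)
    have := Fact.mk hq
    rw [ZMod.exists_sq_eq_prime_iff_of_mod_four_eq_one (by omega) hq2]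
    have hd : (q : ℤ) ∣ p * b ^ 2 - 1 := (Int.natCast_dvd.2 hqa).trans h
    have h1 : (p : ZMod q) * b ^ 2 = 1 := by
      have := (ZMod.intCast_zmod_eq_zero_iff_dvd _ q).2 hd
      push_cast at this
      exact sub_eq_zero.1 this
    -- `p = (pb)²` because `pb² = 1`.
    exact ⟨p * b, by linear_combination -(p : ZMod q) * h1⟩
  have hneg : IsSquare (-1 : ZMod p) := ZMod.exists_sq_eq_neg_one_iff.2 (by omega)
  rcases Int.natAbs_eq a with ha | ha
  · rw [ha]; simpa using hnat
  · rw [ha]; simpa using hneg.mul hnat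

/-! ### Obstructions to the three equations -/

theorem exists_pow_four_eq_two {p : ℕ} [Fact p.Prime] (hp8 : p % 8 = 1) {a b : ℤ}
    (h : 2 * a ^ 2 - p * b ^ 2 = -1) : ∃ z : ZMod p, z ^ 4 = 2 := by
  obtain ⟨r, hr⟩ := isSquare_intCast_of_dvd hp8 (a := a) (b := b) ⟨2 * a, by linarith⟩
  obtain ⟨i, hi⟩ := ZMod.exists_sq_eq_neg_one_iff.2 (by omega : p % 4 ≠ 3)
  obtain ⟨t, ht⟩ := (ZMod.exists_sq_eq_two_iff (by omega : p ≠ 2)).2 (Or.inl hp8)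
  have h1 : 2 * (a : ZMod p) ^ 2 = -1 := by
    have := congrArg (Int.cast : ℤ → ZMod p) h
    push_cast at this
    simpa using this
  have h2 : (2 : ZMod p) ≠ 0 := by
    intro h0
    rw [h0] at h1
    simp at h1
  have ht0 : t ≠ 0 := by rintro rfl; simp [h2] at ht
  have hr0 : r ≠ 0 := by rintro rfl; simp [hr] at h1
  rw [hr] at h1
  -- `2 = -1 / r ^ 4`, and `-1` is the fourth power of `(1 + i) / √2`.
  refine ⟨(1 + i) / (t * r), ?_⟩
  have hi4 : (1 + i) ^ 4 = -4 := by linear_combination (-4 * i - i * i - 5) * hi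
  have ht4 : t ^ 4 = 4 := by linear_combination -(t * t + 2) * ht
  rw [div_pow, mul_pow, hi4, ht4, div_eq_iff (by
    rw [← ht4]; exact mul_ne_zero (pow_ne_zero _ ht0) (pow_ne_zero _ hr0))]
  linear_combination -4 * h1

theorem sq_mod_sixteen_of_forall_prime (n : ℕ)
    (h : ∀ q : ℕ, q.Prime → q ∣ n → q % 8 = 1 ∨ q % 8 = 7) (hn : n ≠ 0) :
    n ^ 2 % 16 = 1 := by
  have : n % 8 = 1 ∨ n % 8 = 7 := by
    induction n using induction_on_primes with
    | zero => simp at hn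
    | one => simp
    | prime_mul q a hq ih =>
      have h1 := h q hq (dvd_mul_right q a)
      have h2 := ih (fun r hr hra ↦ h r hr (hra.mul_left q)) (right_ne_zero_of_mul hn)
      rcases h1 with h1 | h1 <;> rcases h2 with h2 | h2 <;> simp [Nat.mul_mod, h1, h2]
  have h16 : n % 16 = 1 ∨ n % 16 = 7 ∨ n % 16 = 9 ∨ n % 16 = 15 := by omega
  rcases h16 with h | h | h | h <;> simp [Nat.pow_mod, h]

theorem mod_sixteen_eq_one {p : ℕ} (hp8 : p % 8 = 1) {a b : ℤ}
    (h : 2 * a ^ 2 - p * b ^ 2 = 1) : p % 16 = 1 := by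
  have hb : (b.natAbs : ℤ) ^ 2 = b ^ 2 := Int.natAbs_sq b
  have hbodd : ¬ 2 ∣ b := by
    rintro ⟨c, rfl⟩
    have : 2 * (a ^ 2 - 2 * (p * c ^ 2)) = 1 := by linarith
    omega
  have hb16 : b.natAbs ^ 2 % 16 = 1 := by
    refine sq_mod_sixteen_of_forall_prime _ (fun q hq hqb ↦ ?_) (by omega)
    have := Fact.mk hq
    have hqb' : (q : ℤ) ∣ b := Int.natCast_dvd.2 hqb
    refine (ZMod.exists_sq_eq_two_iff ?_).1 ?_
    · rintro rfl
      exact hbodd hqb'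
    · have h0 : (b : ZMod q) = 0 := (ZMod.intCast_zmod_eq_zero_iff_dvd b q).2 hqb'
      have h1 := congrArg (Int.cast : ℤ → ZMod q) h
      push_cast at h1
      rw [h0] at h1
      exact ⟨2 * a, by linear_combination -2 * h1⟩
  have hb16' : b ^ 2 % 16 = 1 := by rw [← hb]; exact_mod_cast hb16
  -- As `pb²` is `1` modulo `8`, `a` is odd, and `2a²` is `2` modulo `16`.
  have hpb : (p * b ^ 2) % 16 = (p : ℤ) % 16 := by rw [Int.mul_emod, hb16']; simp
  have ha : a % 2 = 1 := by
    rcases Int.emod_two_eq_zero_or_one a with h0 | h1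
    · obtain ⟨c, rfl⟩ : 2 ∣ a := Int.dvd_of_emod_eq_zero h0
      have : 8 * c ^ 2 - p * b ^ 2 = 1 := by linarith
      omega
    · exact h1
  have ha8 : a ^ 2 % 8 = 1 := by
    obtain ⟨c, rfl⟩ := Int.odd_iff.2 ha
    obtain ⟨d, hd⟩ := Int.even_mul_succ_self c
    rw [show (2 * c + 1) ^ 2 = 4 * (c * (c + 1)) + 1 by ring, hd]
    omega
  omega

/-- The group `(ZMod p)ˣ` is cyclic, so the fourth powers are the kernel of the power map with
exponent `(p - 1) / 4`. -/
theorem exists_pow_four_eq_iff {p n : ℕ} [Fact p.Prime] (hn : p = 4 * n + 1) {x : ZMod p}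
    (hx : x ≠ 0) : (∃ w : ZMod p, w ^ 4 = x) ↔ x ^ n = 1 := by
  constructor
  · rintro ⟨w, rfl⟩
    have hw : w ≠ 0 := by rintro rfl; simp at hx
    rw [← pow_mul, show 4 * n = p - 1 by omega]
    exact ZMod.pow_card_sub_one_eq_one hw
  · intro h
    obtain ⟨g, hg⟩ := IsCyclic.exists_generator (α := (ZMod p)ˣ)
    obtain ⟨k, hk⟩ := Submonoid.mem_powers_iff _ _ |>.1
      (mem_powers_iff_mem_zpowers.2 (hg (Units.mk0 x hx)))
    have h1 : g ^ (k * n) = 1 := by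
      rw [pow_mul, hk]
      ext
      simpa using h
    have ho : orderOf g = 4 * n := by
      rw [orderOf_eq_card_of_forall_mem_zpowers hg, Nat.card_eq_fintype_card, ZMod.card_units]
      omega
    have hn0 : 0 < n := by have := (Fact.out : p.Prime).one_lt; omega
    have h2 := orderOf_dvd_of_pow_eq_one h1
    rw [ho] at h2
    obtain ⟨l, rfl⟩ := Nat.dvd_of_mul_dvd_mul_right hn0 h2
    refine ⟨(g ^ l : (ZMod p)ˣ), ?_⟩
    have := congrArg Units.val hk
    rw [mul_comm, pow_mul] at this
    simpa using this

theorem exists_pow_four_eq_two_iff {p : ℕ} [Fact p.Prime] (hp8 : p % 8 = 1) {x y : ℤ}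
    (h : x ^ 2 - 2 * p * y ^ 2 = -1) : (∃ z : ZMod p, z ^ 4 = 2) ↔ p % 16 = 1 := by
  have hodd : Odd x := by
    have : Odd (x ^ 2) := ⟨p * y ^ 2 - 1, by linarith⟩
    exact (Int.odd_pow.1 this).resolve_right (by norm_num)
  obtain ⟨v, rfl⟩ := hodd
  have hx2 : ((2 * v + 1 : ℤ) : ZMod p) ^ 2 = -1 := by
    have := congrArg (Int.cast : ℤ → ZMod p) h
    push_cast at this ⊢
    simpa using this
  -- With `x = 2v + 1`, the equation reads `py² - 1 = 2v(v + 1)`.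
  obtain ⟨s, hs⟩ := isSquare_intCast_of_dvd hp8 (a := v + 1) (b := y) ⟨2 * v, by linarith⟩
  obtain ⟨t, ht⟩ := (ZMod.exists_sq_eq_two_iff (by omega : p ≠ 2)).2 (Or.inl hp8)
  set X : ZMod p := ((2 * v + 1 : ℤ) : ZMod p) with hX
  have hX1 : X + 1 = (t * s) ^ 2 := by
    have : X + 1 = 2 * ((v + 1 : ℤ) : ZMod p) := by rw [hX]; push_cast; ring
    rw [this, hs, ht]; ring
  have hX4 : 2 * X = (t * s) ^ 4 := by
    linear_combination (X + 1 + (t * s) ^ 2) * hX1 - hx2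
  have hX0 : X ≠ 0 := by intro h0; simp [h0] at hx2
  have h2 : (2 : ZMod p) ≠ 0 := by
    have : Fact (2 < p) := ⟨by have := (Fact.out : p.Prime).two_le; omega⟩
    exact ZMod.neg_one_ne_one.symm ∘ fun h0 ↦ by linear_combination h0
  have hts : t * s ≠ 0 := by
    intro h0
    rw [h0, zero_pow (by norm_num)] at hX4
    exact mul_ne_zero h2 hX0 hX4
  have hstep : (∃ z : ZMod p, z ^ 4 = 2) ↔ ∃ w : ZMod p, w ^ 4 = X := by
    constructor
    · rintro ⟨z, hz⟩
      refine ⟨t * s / z, ?_⟩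
      rw [div_pow, hz, ← hX4, mul_div_cancel_left₀ _ h2]
    · rintro ⟨w, hw⟩
      refine ⟨t * s / w, ?_⟩
      rw [div_pow, hw, ← hX4, mul_div_cancel_right₀ _ hX0]
  obtain ⟨n, hn⟩ : ∃ n, p = 8 * n + 1 := ⟨p / 8, by omega⟩
  rw [hstep, exists_pow_four_eq_iff (n := 2 * n) (by omega) hX0, pow_mul, hx2,
    neg_one_pow_eq_one_iff_even fun h0 ↦ h2 (by linear_combination -h0), Nat.even_iff]
  omega

/-! ### The quartic symbol and the Pell equations -/

theorem exists_pow_four_of_quarticSymbol_eq_one {a : ℤ} {p : ℕ} (h : quarticSymbol a p = 1) :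
    ∃ z : ZMod p, z ^ 4 = a := by
  unfold quarticSymbol at h
  split_ifs at h
  · simp at h
  · assumption
  · simp at h

theorem not_exists_pow_four_of_quarticSymbol_eq_neg_one {a : ℤ} {p : ℕ}
    (h : quarticSymbol a p = -1) : ¬ ∃ z : ZMod p, z ^ 4 = a := by
  unfold quarticSymbol at h
  split_ifs at h
  assumption

theorem corollary3p5 (p : ℕ) (hp : p.Prime) (hodd : Odd p) :
    (p ≡ 9 [MOD 16] →
      (quarticSymbol 2 p = -1 → ∃ x y : ℤ, x ^ 2 - 2 * (p : ℤ) * y ^ 2 = -1) ∧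
      (quarticSymbol 2 p = 1 → ∃ x y : ℤ, x ^ 2 - 2 * (p : ℤ) * y ^ 2 = -2)) ∧
    (p ≡ 1 [MOD 16] →
      quarticSymbol 2 p = -1 → ∃ x y : ℤ, x ^ 2 - 2 * (p : ℤ) * y ^ 2 = 2) := by
  have := Fact.mk hp
  have hp2 : p ≠ 2 := by rintro rfl; exact absurd hodd (by decide)
  have hpos : quarticSymbol 2 p = 1 → ∃ z : ZMod p, z ^ 4 = 2 := fun h ↦ by
    exact_mod_cast exists_pow_four_of_quarticSymbol_eq_one h
  have hneg : quarticSymbol 2 p = -1 → ¬ ∃ z : ZMod p, z ^ 4 = 2 := fun h ↦ by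
    exact_mod_cast not_exists_pow_four_of_quarticSymbol_eq_neg_one h
  obtain ⟨a, b, h⟩ := exists_half_pell hp hp2
  refine ⟨fun h9 ↦ ?_, fun h1 hq ↦ ?_⟩
  · have h9' : p % 16 = 9 := h9
    have hp8 : p % 8 = 1 := by omega
    refine ⟨fun hq ↦ ?_, fun hq ↦ ?_⟩ <;> rcases h with h | h | h
    · exact ⟨a, b, h⟩
    · have := mod_sixteen_eq_one hp8 h
      omega
    · exact absurd (exists_pow_four_eq_two hp8 h) (hneg hq)
    · have := (exists_pow_four_eq_two_iff hp8 h).1 (hpos hq)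
      omega
    · have := mod_sixteen_eq_one hp8 h
      omega
    · exact ⟨2 * a, b, by linarith⟩
  · have h1' : p % 16 = 1 := h1
    have hp8 : p % 8 = 1 := by omega
    rcases h with h | h | h
    · exact absurd ((exists_pow_four_eq_two_iff hp8 h).2 h1') (hneg hq)
    · exact ⟨2 * a, b, by linarith⟩
    · exact absurd (exists_pow_four_eq_two hp8 h) (hneg hq)
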